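/- Fix $\theta\in\mathbb R$, $\tau\ge 0$ and $q\in(-1,1)$, and write $[n]_q=\sum_{j=0}^{n-1}q^j$ (so $[0]_q=0$). An orthogonality measure of a sequence of monic polynomials is a probability measure on $\mathbb R$ with finite moments of all orders with respect to which distinct members of the sequence are orthogonal. For $0\le s<t$ and $x\in\mathbb R$ let $P_{s,t}(x,dy)$, the transition probability of the $q$-Meixner process, be the orthogonality measure of the monic polynomials $Q_n(y|x,s,t)$ in $y$ given by $Q_0=1$, $Q_1=y-x$ and, for $n\ge1$, $$yQ_n=Q_{n+1}+(\theta[n]_q+xq^n)Q_n+(t-sq^{n-1}+\tau[n-1]_q)[n]_q\,Q_{n-1}.$$ For $t>0$ and $x\in\mathbb R$ let $\nu_{x,t}(dy)$ be the orthogonality measure of the monic polynomials $W_n(y;x,t)$ in $y$ given by $W_{-1}=0$, $W_0=1$ and, for $n\ge0$, $$yW_n=W_{n+1}+(\theta[n+1]_q+xq^{n+1})W_n+((1-q)t+\tau)[n]_q[n+1]_q\,W_{n-1}.$$ These measures exist and are unique. Let $\mathsf P_{s,t}f(x)=\int f(y)\,P_{s,t}(x,dy)$. For $t>0$ the domain $\mathcal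 D_t^-$ of the weak left generator consists of the bounded continuous $f:\mathbb R\to\mathbb R$ for which the functions $\frac1h(\mathsf P_{t-h,t}f-f)$, $0<h\le t$, are bounded in supremum norm uniformly in $h$ and converge pointwise as $h\to0^+$; the limit is $\mathbb A_t^-f$. The domain $\mathcal D_t^+$ of the weak right generator and $\mathbb A_t^+f$ are defined in the same way from $\frac1h(\mathsf P_{t,t+h}f-f)$, $h>0$. For a polynomial $f$ let $\widetilde{\mathbb A}_t^{-}f$ and $\widetilde{\mathbb A}_t^{+}f$ denote the pointwise limits of the same expressions. Let $t>0$. (i) If $f:\mathbb R\to\mathbb R$ is bounded and continuous with bounded continuous second derivative, then $f\in\mathcal D_t^-\cap\mathcal D_t^+$, both weak generators coincide on $f$, and for every $x\in\mathbb R$ $$\mathbb A_t^{\pm}(f)(x)=\tfrac12 f''(x)\,\nu_{x,t}(\{x\})+\int_{\mathbb R\setminus\{x\}}\Big(\frac{\partial}{\partial x}\frac{f(y)-f(x)}{y-x}\Big)\nu_{x,t}(dy),$$ where the integrand is integrable. (ii) If $f$ is a polynomial, then for every $x\in\mathbb R$ the limits defining $\widetilde{\mathbb A}_t^{\pm}(f)(x)$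 exist, are equal, and are given by the right-hand side of the formula in (i), which then also equals $$\int_{\mathbb R}\Big(\frac{\partial}{\partial x}\frac{f(y)-f(x)}{y-x}\Big)\nu_{x,t}(dy),$$ where $\frac{f(y)-f(x)}{y-x}$ is read as a polynomial in $x$ and $y$ (with the value $f'(x)$ at $y=x$). All integrands are integrable. -/

import Mathlib

open Filter Topology MeasureTheory Polynomial
open scoped BoundedContinuousFunction

noncomputable section

namespace QMeixner

/-- The `q`-integer `[n]_q = 1 + q + ... + q^(n-1)`, with `[0]_q = 0`. -/
def qInt (q : ℝ) (n : ℕ) : ℝ := ∑ j ∈ Finset.range n, q ^ j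

/-- The monic polynomials `Q_n(y | x, s, t)` in the variable `y`:
`Q_0 = 1`, `Q_1 = y - x` and, for `n ≥ 1`,
`y Q_n = Q_{n+1} + (θ [n]_q + x q^n) Q_n + (t - s q^(n-1) + τ [n-1]_q) [n]_q Q_{n-1}`.
The recurrence is written here with `n + 1` in place of `n`, solved for the leading term. -/
def transPoly (θ τ q s t x : ℝ) : ℕ → ℝ[X]
  | 0 => 1
  | 1 => X - C x
  | n + 2 =>
      (X - C (θ * qInt q (n + 1) + x * q ^ (n + 1))) * transPoly θ τ q s t x (n + 1)
        - C ((t - s * q ^ n + τ * qInt q n) * qInt q (n + 1)) * transPoly θ τ q s t x n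

/-- The monic polynomials `W_n(y; x, t)` in the variable `y`: `W_{-1} = 0`, `W_0 = 1` and, for
`n ≥ 0`, `y W_n = W_{n+1} + (θ [n+1]_q + x q^(n+1)) W_n + ((1-q) t + τ) [n]_q [n+1]_q W_{n-1}`. -/
def genPoly (θ τ q x t : ℝ) : ℕ → ℝ[X]
  | 0 => 1
  | 1 => X - C (θ * qInt q 1 + x * q ^ 1)
  | n + 2 =>
      (X - C (θ * qInt q (n + 2) + x * q ^ (n + 2))) * genPoly θ τ q x t (n + 1)
        - C (((1 - q) * t + τ) * qInt q (n + 1) * qInt q (n + 2)) * genPoly θ τ q x t n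

/-- `μ` is a (normalized) orthogonality measure of the sequence of polynomials `p`: a probability
measure with finite moments of all orders for which distinct members of `p` are orthogonal. -/
structure IsOrthogonalityMeasure (p : ℕ → ℝ[X]) (μ : Measure ℝ) : Prop where
  isProbabilityMeasure : IsProbabilityMeasure μ
  integrable : ∀ n : ℕ, Integrable (fun y : ℝ => y ^ n) μ
  orthogonal : ∀ m n : ℕ, m ≠ n → ∫ y, (p m).eval y * (p n).eval y ∂μ = 0

open Classical in
/-- The orthogonality measure of `p` (the zero measure if there is none). -/
def orthogonalityMeasure (p : ℕ → ℝ[X]) : Measure ℝ :=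
  if h : ∃ μ, IsOrthogonalityMeasure p μ then h.choose else 0

/-- The transition probability `P_{s,t}(x, dy)` of the `q`-Meixner process. -/
def transProb (θ τ q s t x : ℝ) : Measure ℝ :=
  orthogonalityMeasure (transPoly θ τ q s t x)

/-- The measure `ν_{x,t}(dy)`. -/
def genMeasure (θ τ q x t : ℝ) : Measure ℝ :=
  orthogonalityMeasure (genPoly θ τ q x t)

/-- The transition operator `(P_{s,t} f)(x) = ∫ f(y) P_{s,t}(x, dy)`. -/
def transOp (θ τ q s t : ℝ) (f : ℝ → ℝ) (x : ℝ) : ℝ :=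
  ∫ y, f y ∂(transProb θ τ q s t x)

/-- `(1/h) (P_{t-h,t} f - f)(x)`. -/
def leftQuotient (θ τ q t : ℝ) (f : ℝ → ℝ) (h x : ℝ) : ℝ :=
  1 / h * (transOp θ τ q (t - h) t f x - f x)

/-- `(1/h) (P_{t,t+h} f - f)(x)`. -/
def rightQuotient (θ τ q t : ℝ) (f : ℝ → ℝ) (h x : ℝ) : ℝ :=
  1 / h * (transOp θ τ q t (t + h) f x - f x)

/-- The domain of the weak left infinitesimal generator at time `t`: the bounded continuous `f` for
which `(1/h) (P_{t-h,t} f - f)`, `0 < h ≤ t`, is bounded in the supremum norm and converges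
pointwise as `h → 0+`. -/
def weakLeftDomain (θ τ q t : ℝ) : Set (ℝ →ᵇ ℝ) :=
  {f | (∃ K : ℝ, ∀ h : ℝ, 0 < h → h ≤ t → ∀ x : ℝ, |leftQuotient θ τ q t f h x| ≤ K) ∧
    ∀ x : ℝ, ∃ a : ℝ, Tendsto (fun h => leftQuotient θ τ q t f h x) (𝓝[>] 0) (𝓝 a)}

/-- The domain of the weak right infinitesimal generator at time `t`: the bounded continuous `f` for
which `(1/h) (P_{t,t+h} f - f)`, `h > 0`, is bounded in the supremum norm and converges
pointwise as `h → 0+`. -/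
def weakRightDomain (θ τ q t : ℝ) : Set (ℝ →ᵇ ℝ) :=
  {f | (∃ K : ℝ, ∀ h : ℝ, 0 < h → ∀ x : ℝ, |rightQuotient θ τ q t f h x| ≤ K) ∧
    ∀ x : ℝ, ∃ a : ℝ, Tendsto (fun h => rightQuotient θ τ q t f h x) (𝓝[>] 0) (𝓝 a)}

/-- The left infinitesimal generator: the pointwise limit of `(1/h) (P_{t-h,t} f - f)(x)`. -/
def leftGenerator (θ τ q t : ℝ) (f : ℝ → ℝ) (x : ℝ) : ℝ :=
  limUnder (𝓝[>] (0 : ℝ)) (fun h => leftQuotient θ τ q t f h x)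

/-- The right infinitesimal generator: the pointwise limit of `(1/h) (P_{t,t+h} f - f)(x)`. -/
def rightGenerator (θ τ q t : ℝ) (f : ℝ → ℝ) (x : ℝ) : ℝ :=
  limUnder (𝓝[>] (0 : ℝ)) (fun h => rightQuotient θ τ q t f h x)

/-- `∂/∂x [(f(y) - f(x)) / (y - x)]`, meaningful for `y ≠ x`. -/
def quotDeriv (f : ℝ → ℝ) (x y : ℝ) : ℝ :=
  deriv (fun z => (f y - f z) / (y - z)) x

/-- `∂/∂x [(f(y) - f(x)) / (y - x)]` for all `x`, `y`, where the quotient is continued to the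
diagonal by the value `f'(x)` at `y = x`; for a polynomial `f` the continued quotient is
a polynomial in `x` and `y`. -/
def quotDerivExt (f : ℝ → ℝ) (x y : ℝ) : ℝ :=
  deriv (fun z => dslope f z y) x

/-- `½ f''(x) ν_{x,t}({x}) + ∫_{ℝ ∖ {x}} ∂/∂x [(f(y) - f(x)) / (y - x)] ν_{x,t}(dy)`. -/
def singularIntegral (θ τ q t : ℝ) (f : ℝ → ℝ) (x : ℝ) : ℝ :=
  1 / 2 * iteratedDeriv 2 f x * (genMeasure θ τ q x t).real {x}
    + ∫ y in {x}ᶜ, quotDeriv f x y ∂(genMeasure θ τ q x t)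

end QMeixner

end

/-!
The transition probabilities and the measures `ν_{x,t}` are spectral measures of Jacobi operators.
Let `J_{s,t}` be the bounded self-adjoint operator on a Hilbert space with basis `e₀, e₁, …` whose
diagonal `bₙ = θ [n]_q + x q ^ n` and squared off-diagonal
`aₙ = (t - s q ^ n + τ [n]_q) [n+1]_q ≥ 0` are read off the recurrence of the `Qₙ`. As `Qₙ(J) e₀` is
a multiple of `eₙ`, the spectral measure of `J_{s,t}` at `e₀` is an orthogonality measure
(`IsJacobiOperator.isOrthogonalityMeasure`). It has bounded support, so it is the only one
(`ext_of_integral_pow_eq`).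

For `f` of class `C²` write `f y = f x + f' x (y - x) + (y - x) g(y) (y - x)`. The continuous
function `g` is `∂/∂x [(f y - f x) / (y - x)]` off the diagonal and `f'' x / 2` at `y = x`, so the
singular integral of the theorem is `∫ g dν_{x,t}`. Because `b₀ = x` and `a₀ = t - s`, one has
`(J_{s,t} - x) e₀ = √(t - s) e₁`, and the functional calculus gives the exact identity
`(P_{s,t} f - f)(x) / (t - s) = ⟨e₁, g(J_{s,t}) e₁⟩` (`IsJacobiOperator.integral_sub_eq`). The right
side is at most `sup |g| ≤ sup |f''| / 2`, and it is continuous in `(s, t)`, because `J_{s,t}`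
depends norm-continuously on `(s, t)`. On the diagonal `s = t` the entry `a₀` vanishes and `J_{t,t}`
splits off `e₀`; the remaining Jacobi coefficients are exactly those of the `Wₙ`, so
`⟨e₁, g(J_{t,t}) e₁⟩ = ∫ g dν_{x,t}` (`exists_quotient_representation`). The
identity holds for every `C²` function, which lets bounded functions and polynomials be treated
together (`tendsto_quotients`).
-/

namespace QMeixner

/-! ### Spectral measures of bounded self-adjoint operators -/

section SpectralMeasure

variable {H : Type*} [NormedAddCommGroup H] [InnerProductSpace ℂ H] [CompleteSpace H]

/-- `μ` is the spectral measure of the self-adjoint operator `T` at the vector `v`: a finite measure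
carried by `[-‖T‖, ‖T‖]` with `∫ f dμ = ⟨v, f(T) v⟩` for all continuous `f`. The norm of `T` is
used instead of its spectrum, so that the supports stay in one compact set when `T` varies. -/
structure IsSpectralMeasure (T : H →L[ℂ] H) (v : H) (μ : Measure ℝ) : Prop where
  isFiniteMeasure : IsFiniteMeasure μ
  ae_mem : ∀ᵐ y ∂μ, y ∈ Set.Icc (-‖T‖) ‖T‖
  integral_eq : ∀ f : ℝ → ℝ, Continuous f → ∫ y, f y ∂μ = (inner ℂ v (cfc f T v)).re

theorem spectrum_subset_Icc (T : H →L[ℂ] H) : spectrum ℝ T ⊆ Set.Icc (-‖T‖) ‖T‖ := by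
  intro k hk
  have h := spectrum.norm_le_norm_mul_of_mem hk
  have h1 : ‖(1 : H →L[ℂ] H)‖ ≤ 1 := ContinuousLinearMap.norm_id_le
  have : |k| ≤ ‖T‖ := h.trans (by nlinarith [norm_nonneg T])
  exact abs_le.mp this

/-- The Riesz–Markov–Kakutani measure of the functional `f ↦ ⟨v, f(T) v⟩` on the spectrum of `T`. -/
theorem exists_isSpectralMeasure {T : H →L[ℂ] H} (hT : IsSelfAdjoint T) (v : H) :
    ∃ μ, IsSpectralMeasure T v μ := by
  let X := spectrum ℝ T
  have : CompactSpace X := isCompact_iff_compactSpace.mp (spectrum.isCompact T)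
  let Λ₀ : CompactlySupportedContinuousMap X ℝ →ₗ[ℝ] ℝ :=
    { toFun := fun f => (inner ℂ v (cfcHom hT (f : C(X, ℝ)) v)).re
      map_add' := fun f g => by
        have : ((f + g : CompactlySupportedContinuousMap X ℝ) : C(X, ℝ)) = (f : C(X, ℝ)) + g := rfl
        rw [this, map_add]
        simp
      map_smul' := fun c f => by
        have : ((c • f : CompactlySupportedContinuousMap X ℝ) : C(X, ℝ)) = c • (f : C(X, ℝ)) := rfl
        rw [this, map_smul]
        simp [inner_smul_right_eq_smul] }
  have hpos : ∀ f, 0 ≤ f → 0 ≤ Λ₀ f := by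
    intro f hf
    have h1 : (0 : H →L[ℂ] H) ≤ cfcHom hT (f : C(X, ℝ)) := (cfcHom_nonneg_iff hT).2 fun x => hf x
    rw [ContinuousLinearMap.nonneg_iff_isPositive] at h1
    have := h1.inner_nonneg_right v
    exact (Complex.le_def.1 this).1
  let Λ := PositiveLinearMap.mk₀ Λ₀ hpos
  let μ := RealRMK.rieszMeasure Λ
  have hfin : IsFiniteMeasure μ := inferInstance
  refine ⟨μ.map (Subtype.val : X → ℝ), inferInstance, ?_, fun f hf => ?_⟩
  · exact (ae_map_iff measurable_subtype_coe.aemeasurable measurableSet_Icc).2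
      (.of_forall fun x => spectrum_subset_Icc T x.2)
  · rw [integral_map measurable_subtype_coe.aemeasurable hf.aestronglyMeasurable]
    have h := RealRMK.integral_rieszMeasure Λ
      (CompactlySupportedContinuousMap.continuousMapEquiv ⟨fun x : X => f x, by fun_prop⟩)
    refine h.trans ?_
    rw [cfc_apply f T hT hf.continuousOn]
    rfl

end SpectralMeasure

/-! ### Measures determined by their moments -/

theorem integrable_of_ae_mem_Icc {μ : Measure ℝ} [IsFiniteMeasure μ] {R : ℝ}
    (h : ∀ᵐ y ∂μ, y ∈ Set.Icc (-R) R) {f : ℝ → ℝ} (hf : Continuous f) : Integrable f μ := by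
  obtain ⟨K, hK⟩ := (isCompact_Icc (a := -R) (b := R)).exists_bound_of_continuousOn hf.continuousOn
  exact Integrable.of_bound hf.aestronglyMeasurable K (h.mono fun y hy => hK y hy)

/-- Chebyshev's inequality for all even powers: if `∫ y ^ (2k) dμ` grows at most like `R ^ (2k)`,
then `μ` is carried by `[-R, R]`. -/
theorem ae_mem_Icc_of_integral_pow_le {μ : Measure ℝ} [IsFiniteMeasure μ] {R M : ℝ} (hR : 0 ≤ R)
    (hint : ∀ n : ℕ, Integrable (fun y : ℝ => y ^ n) μ)
    (hle : ∀ k : ℕ, ∫ y, y ^ (2 * k) ∂μ ≤ R ^ (2 * k) * M) :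
    ∀ᵐ y ∂μ, y ∈ Set.Icc (-R) R := by
  have key : ∀ n : ℕ, ∀ᵐ y ∂μ, |y| < R + 1 / (n + 1 : ℝ) := by
    intro n
    set r : ℝ := R + 1 / (n + 1 : ℝ) with hr
    have hRr : R < r := by rw [hr]; linarith [Nat.one_div_pos_of_nat (α := ℝ) (n := n)]
    have hr0 : 0 < r := hR.trans_lt hRr
    have h1 : ∀ k : ℕ, μ.real {y | r ≤ |y|} ≤ ((R / r) ^ 2) ^ k * M := by
      intro k
      have h2 := mul_meas_ge_le_integral_of_nonneg (μ := μ) (f := fun y : ℝ => y ^ (2 * k))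
        (.of_forall fun y => by simp only [pow_mul]; positivity) (hint _) (r ^ (2 * k))
      have h3 : μ.real {y | r ≤ |y|} ≤ μ.real {y | r ^ (2 * k) ≤ y ^ (2 * k)} := by
        refine measureReal_mono fun y hy => ?_
        have : r ^ (2 * k) ≤ |y| ^ (2 * k) := pow_le_pow_left₀ hr0.le hy _
        simpa [pow_mul, sq_abs] using this
      have h4 : r ^ (2 * k) * μ.real {y | r ≤ |y|} ≤ R ^ (2 * k) * M :=
        (mul_le_mul_of_nonneg_left h3 (by positivity)).trans (h2.trans (hle k))
      rw [← pow_mul, div_pow, div_mul_eq_mul_div, le_div_iff₀ (by positivity)]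
      linarith
    have h5 : Tendsto (fun k : ℕ => ((R / r) ^ 2) ^ k * M) atTop (𝓝 (0 * M)) := by
      refine (tendsto_pow_atTop_nhds_zero_of_lt_one (by positivity) ?_).mul_const M
      have : R / r < 1 := (div_lt_one hr0).2 hRr
      have h0 : 0 ≤ R / r := by positivity
      nlinarith
    have h6 : μ.real {y | r ≤ |y|} ≤ 0 := by
      simpa using ge_of_tendsto' h5 h1
    have h7 : μ {y | r ≤ |y|} = 0 := by
      rw [← measureReal_eq_zero_iff]
      exact le_antisymm h6 measureReal_nonneg
    rw [ae_iff]
    simpa using h7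
  filter_upwards [ae_all_iff.2 key] with y hy
  have hlim : Tendsto (fun n : ℕ => R + 1 / (n + 1 : ℝ)) atTop (𝓝 (R + 0)) :=
    tendsto_one_div_add_atTop_nhds_zero_nat.const_add R
  exact abs_le.1 (by simpa using ge_of_tendsto' hlim fun n => (hy n).le)

/-- A finite measure carried by a bounded interval is determined by its moments, among all finite
measures with finite moments. -/
theorem ext_of_integral_pow_eq {μ ν : Measure ℝ} [IsFiniteMeasure μ] [IsFiniteMeasure ν] {R : ℝ}
    (hR : 0 ≤ R) (hν : ∀ᵐ y ∂ν, y ∈ Set.Icc (-R) R)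
    (hint : ∀ n : ℕ, Integrable (fun y : ℝ => y ^ n) μ)
    (h : ∀ p : ℝ[X], ∫ y, p.eval y ∂μ = ∫ y, p.eval y ∂ν) : μ = ν := by
  have hμ : ∀ᵐ y ∂μ, y ∈ Set.Icc (-R) R := by
    refine ae_mem_Icc_of_integral_pow_le (M := ν.real Set.univ) hR hint fun k => ?_
    have h1 := h (X ^ (2 * k))
    simp only [eval_pow, eval_X] at h1
    rw [h1]
    have h2 := norm_integral_le_of_norm_le_const (μ := ν) (f := fun y : ℝ => y ^ (2 * k))
      (C := R ^ (2 * k)) (hν.mono fun y hy => by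
        rw [norm_pow]; exact pow_le_pow_left₀ (norm_nonneg _) (abs_le.2 hy) _)
    exact (le_abs_self _).trans h2
  refine ext_of_forall_integral_eq_of_IsFiniteMeasure fun f => ?_
  have hbound : ∀ (ρ : Measure ℝ) [IsFiniteMeasure ρ], (∀ᵐ y ∂ρ, y ∈ Set.Icc (-R) R) →
      ∀ (ε : ℝ) (p : ℝ[X]), (∀ x ∈ Set.Icc (-R) R, |eval x p - f x| < ε) →
      |∫ y, p.eval y ∂ρ - ∫ y, f y ∂ρ| ≤ ε * ρ.real Set.univ := by
    intro ρ _ hρ ε p hp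
    rw [← integral_sub (integrable_of_ae_mem_Icc hρ p.continuous)
      (integrable_of_ae_mem_Icc hρ f.continuous)]
    exact norm_integral_le_of_norm_le_const (f := fun y => p.eval y - f y)
      (hρ.mono fun y hy => (hp y hy).le)
  have hle : ∀ ε : ℝ, 0 < ε →
      |∫ y, f y ∂μ - ∫ y, f y ∂ν| ≤ ε * (μ.real Set.univ + ν.real Set.univ) := by
    intro ε hε
    obtain ⟨p, hp⟩ := exists_polynomial_near_of_continuousOn (-R) R f f.continuous.continuousOn ε hε
    have h1 := abs_le.1 (hbound μ hμ ε p hp)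
    have h2 := abs_le.1 (hbound ν hν ε p hp)
    rw [h p] at h1
    rw [abs_le]
    constructor <;> linarith [h1.1, h1.2, h2.1, h2.2]
  have hlim : Tendsto (fun ε : ℝ => ε * (μ.real Set.univ + ν.real Set.univ)) (𝓝[>] 0)
      (𝓝 (0 * (μ.real Set.univ + ν.real Set.univ))) :=
    (tendsto_nhdsWithin_of_tendsto_nhds tendsto_id).mul_const _
  have h0 := ge_of_tendsto hlim (eventually_mem_nhdsWithin.mono fun ε hε => hle ε hε)
  rw [zero_mul] at h0
  exact sub_eq_zero.1 (abs_eq_zero.1 (le_antisymm h0 (abs_nonneg _)))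

/-! ### Monic polynomials given by a three-term recurrence -/

/-- The monic polynomials with `p₀ = 1`, `p₁ = y - b₀` and
`y pₙ₊₁ = pₙ₊₂ + bₙ₊₁ pₙ₊₁ + aₙ pₙ`; the index of `a` is one lower than usual. -/
noncomputable def recPoly (b a : ℕ → ℝ) : ℕ → ℝ[X]
  | 0 => 1
  | 1 => X - C (b 0)
  | n + 2 => (X - C (b (n + 1))) * recPoly b a (n + 1) - C (a n) * recPoly b a n

theorem recPoly_monic_natDegree (b a : ℕ → ℝ) (n : ℕ) :
    (recPoly b a n).Monic ∧ (recPoly b a n).natDegree = n := by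
  induction n using Nat.strong_induction_on with
  | _ n ih =>
    match n with
    | 0 => simp [recPoly]
    | 1 => exact ⟨monic_X_sub_C _, natDegree_X_sub_C _⟩
    | n + 2 =>
      obtain ⟨m1, d1⟩ := ih (n + 1) (by omega)
      obtain ⟨m0, d0⟩ := ih n (by omega)
      have m2 := (monic_X_sub_C (b (n + 1))).mul m1
      have d2 : ((X - C (b (n + 1))) * recPoly b a (n + 1)).natDegree = n + 2 := by
        rw [(monic_X_sub_C (b (n + 1))).natDegree_mul m1, natDegree_X_sub_C, d1]; omega
      have hlt : (C (a n) * recPoly b a n).degree <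
          ((X - C (b (n + 1))) * recPoly b a (n + 1)).degree := by
        rw [degree_eq_natDegree m2.ne_zero, d2]
        refine (degree_le_of_natDegree_le (n := n) ?_).trans_lt (by exact_mod_cast (by omega))
        exact (natDegree_C_mul_le _ _).trans d0.le
      exact ⟨m2.sub_of_left hlt, by
        rw [recPoly, natDegree_eq_of_degree_eq (degree_sub_eq_left_of_degree_lt hlt), d2]⟩

theorem IsOrthogonalityMeasure.integrable_eval {p : ℕ → ℝ[X]} {μ : Measure ℝ}
    (h : IsOrthogonalityMeasure p μ) (r : ℝ[X]) : Integrable (fun y => r.eval y) μ := by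
  simp only [eval_eq_sum_range]
  exact integrable_finsetSum _ fun i _ => (h.integrable i).const_mul _

/-- Orthogonality to `p₀ = 1` alone fixes the integral of every polynomial. -/
theorem IsOrthogonalityMeasure.integral_eval_eq {b a : ℕ → ℝ} {μ ν : Measure ℝ}
    (hμ : IsOrthogonalityMeasure (recPoly b a) μ) (hν : IsOrthogonalityMeasure (recPoly b a) ν)
    (r : ℝ[X]) : ∫ y, r.eval y ∂μ = ∫ y, r.eval y ∂ν := by
  have hP : ∀ n, ∫ y, (recPoly b a n).eval y ∂μ = ∫ y, (recPoly b a n).eval y ∂ν := by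
    intro n
    rcases Nat.eq_zero_or_pos n with rfl | hn
    · have := hμ.isProbabilityMeasure
      have := hν.isProbabilityMeasure
      simp [recPoly]
    · have h1 := hμ.orthogonal n 0 hn.ne'
      have h2 := hν.orthogonal n 0 hn.ne'
      simp only [recPoly, eval_one, mul_one] at h1 h2
      rw [h1, h2]
  have main : ∀ n : ℕ, ∀ r : ℝ[X], r.degree < n → ∫ y, r.eval y ∂μ = ∫ y, r.eval y ∂ν := by
    intro n
    induction n with
    | zero =>
      intro r hr
      have : r = 0 := by simpa using hr
      simp [this]
    | succ n ih =>
      intro r hr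
      obtain ⟨hm, hd⟩ := recPoly_monic_natDegree b a n
      -- Removing a multiple of `recPoly b a n` lowers the degree.
      set r' := r - C (r.coeff n) * recPoly b a n with hr'
      have hdeg : r'.degree < n := by
        rw [degree_lt_iff_coeff_zero]
        intro m hm'
        rcases hm'.eq_or_lt with rfl | hlt
        · have : (recPoly b a n).coeff n = 1 := by
            have := hm.coeff_natDegree
            rwa [hd] at this
          simp [hr', this]
        · have h1 : r.coeff m = 0 :=
            coeff_eq_zero_of_degree_lt (hr.trans_le (by exact_mod_cast hlt))
          have h2 : (recPoly b a n).coeff m = 0 :=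
            coeff_eq_zero_of_natDegree_lt (hd.trans_lt hlt)
          simp [hr', h1, h2]
      have hsplit : ∀ y, r.eval y = r'.eval y + r.coeff n * (recPoly b a n).eval y := by
        intro y; simp [hr']
      simp only [hsplit]
      rw [integral_add (hμ.integrable_eval _) ((hμ.integrable_eval _).const_mul _),
        integral_add (hν.integrable_eval _) ((hν.integrable_eval _).const_mul _),
        integral_const_mul, integral_const_mul, hP, ih r' hdeg]
  refine main (r.natDegree + 1) r (degree_le_natDegree.trans_lt ?_)
  exact_mod_cast Nat.lt_succ_self _

theorem IsOrthogonalityMeasure.eq_of_ae_mem_Icc {b a : ℕ → ℝ} {μ ν : Measure ℝ} {R : ℝ}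
    (hR : 0 ≤ R) (hμ : IsOrthogonalityMeasure (recPoly b a) μ)
    (hν : IsOrthogonalityMeasure (recPoly b a) ν) (hsupp : ∀ᵐ y ∂ν, y ∈ Set.Icc (-R) R) :
    μ = ν := by
  have := hμ.isProbabilityMeasure
  have := hν.isProbabilityMeasure
  exact ext_of_integral_pow_eq hR hsupp hμ.integrable (hμ.integral_eval_eq hν)

theorem orthogonalityMeasure_spec {p : ℕ → ℝ[X]} {μ : Measure ℝ}
    (h : IsOrthogonalityMeasure p μ) :
    IsOrthogonalityMeasure p (orthogonalityMeasure p) := by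
  have hex : ∃ μ, IsOrthogonalityMeasure p μ := ⟨μ, h⟩
  rw [orthogonalityMeasure, dif_pos hex]
  exact hex.choose_spec

/-! ### Jacobi operators -/

section JacobiOperator

variable {H : Type*} [NormedAddCommGroup H] [InnerProductSpace ℂ H]

/-- The diagonal operator with bounded real entries `β` in the Hilbert basis `e`. -/
noncomputable def diagOp (e : HilbertBasis ℕ ℂ H) (β : ℕ →ᵇ ℝ) : H →L[ℂ] H :=
  LinearMap.mkContinuous
    { toFun := fun v => e.repr.symm ⟨fun n => (β n : ℂ) * e.repr v n,
        ((lp.memℓp (e.repr v)).const_smul (‖β‖ : ℂ)).mono' fun n => by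
          simp only [norm_mul, Complex.norm_real, Pi.smul_apply, smul_eq_mul, norm_norm]
          gcongr
          exact β.norm_coe_le_norm n⟩
      map_add' := fun v w => by
        rw [← map_add]
        congr 1
        ext n
        simp only [map_add, lp.coeFn_add, Pi.add_apply, mul_add]
      map_smul' := fun c v => by
        rw [RingHom.id_apply, ← map_smul]
        congr 1
        ext n
        simp [mul_left_comm] } ‖β‖ fun v => by
    simp only [LinearMap.coe_mk, AddHom.coe_mk, LinearIsometryEquiv.norm_map]
    have h : ‖β‖ * ‖v‖ = ‖(‖β‖ : ℂ) • e.repr v‖ := by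
      rw [norm_smul, e.repr.norm_map, Complex.norm_real, norm_norm]
    rw [h]
    refine lp.norm_mono two_ne_zero fun n => ?_
    simp only [lp.coeFn_smul, Pi.smul_apply, smul_eq_mul, norm_mul, Complex.norm_real, norm_norm]
    gcongr
    exact β.norm_coe_le_norm n

theorem repr_diagOp (e : HilbertBasis ℕ ℂ H) (β : ℕ →ᵇ ℝ) (v : H) (n : ℕ) :
    e.repr (diagOp e β v) n = (β n : ℂ) * e.repr v n := by
  simp [diagOp]

theorem norm_diagOp_le (e : HilbertBasis ℕ ℂ H) (β : ℕ →ᵇ ℝ) : ‖diagOp e β‖ ≤ ‖β‖ :=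
  LinearMap.mkContinuous_norm_le _ (norm_nonneg _) _

theorem diagOp_sub (e : HilbertBasis ℕ ℂ H) (β γ : ℕ →ᵇ ℝ) :
    diagOp e (β - γ) = diagOp e β - diagOp e γ := by
  ext v
  apply e.repr.injective
  ext n
  simp [repr_diagOp, sub_mul]

theorem diagOp_apply_self (e : HilbertBasis ℕ ℂ H) (β : ℕ →ᵇ ℝ) (n : ℕ) :
    diagOp e β (e n) = (β n : ℂ) • e n := by
  apply e.repr.injective
  ext m
  rw [repr_diagOp, map_smul, e.repr_self, lp.coeFn_smul, Pi.smul_apply, smul_eq_mul]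
  by_cases h : m = n
  · rw [h]
  · simp [lp.single_apply, h]

/-- Vectors with the same coordinates in a Hilbert basis agree. -/
theorem ext_inner_basis (e : HilbertBasis ℕ ℂ H) {v w : H}
    (h : ∀ n, inner ℂ (e n) v = inner ℂ (e n) w) : v = w := by
  apply e.repr.injective
  ext n
  rw [e.repr_apply_apply, e.repr_apply_apply, h]

variable [CompleteSpace H]

/-- The bounded self-adjoint operator `T` acts on the sequence `e` as the symmetric tridiagonal
matrix with diagonal `b` and off-diagonal `√a`. -/
structure IsJacobiOperator (T : H →L[ℂ] H) (e : ℕ → H) (b a : ℕ → ℝ) : Prop where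
  isSelfAdjoint : IsSelfAdjoint T
  apply_zero : T (e 0) = (b 0 : ℂ) • e 0 + (√(a 0) : ℂ) • e 1
  apply_succ : ∀ n, T (e (n + 1)) =
    (√(a n) : ℂ) • e n + (b (n + 1) : ℂ) • e (n + 1) + (√(a (n + 1)) : ℂ) • e (n + 2)

/-- If the first off-diagonal entry vanishes, the matrix splits off its first row and column. -/
theorem IsJacobiOperator.tail {T : H →L[ℂ] H} {e : ℕ → H} {b a : ℕ → ℝ}
    (h : IsJacobiOperator T e b a) (ha : a 0 = 0) :
    IsJacobiOperator T (fun n => e (n + 1)) (fun n => b (n + 1)) (fun n => a (n + 1)) where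
  isSelfAdjoint := h.isSelfAdjoint
  apply_zero := by simpa [ha] using h.apply_succ 0
  apply_succ n := h.apply_succ (n + 1)

/-- The polynomials of the recurrence, applied to `T`, move `e₀` along the sequence `e`. -/
theorem IsJacobiOperator.aeval_recPoly {T : H →L[ℂ] H} {e : ℕ → H} {b a : ℕ → ℝ}
    (h : IsJacobiOperator T e b a) (ha : ∀ n, 0 ≤ a n) (n : ℕ) :
    aeval T (recPoly b a n) (e 0) = ((∏ i ∈ Finset.range n, √(a i) : ℝ) : ℂ) • e n := by
  induction n using Nat.strong_induction_on with
  | _ n ih =>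
    match n with
    | 0 => simp [recPoly]
    | 1 =>
      simp [recPoly, h.apply_zero, Algebra.algebraMap_eq_smul_one]
    | n + 2 =>
      have h1 := ih (n + 1) (by omega)
      have h0 := ih n (by omega)
      have hsq : (√(a n) : ℂ) * (√(a n) : ℂ) = (a n : ℂ) := by
        exact_mod_cast Real.mul_self_sqrt (ha n)
      have hC : ∀ (r : ℝ) (v : H), aeval T (C r) v = (r : ℂ) • v := by
        intro r v
        simp [Algebra.algebraMap_eq_smul_one]
      rw [recPoly, map_sub, map_mul, map_mul, map_sub, sub_apply,
        mul_apply_eq_comp, mul_apply_eq_comp, h1, h0,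
        sub_apply, hC, hC, aeval_X, map_smul, h.apply_succ,
        Finset.prod_range_succ _ (n + 1), Finset.prod_range_succ _ n, ← hsq]
      push_cast
      module

theorem cfc_polynomial_eval {T : H →L[ℂ] H} (hT : IsSelfAdjoint T) (p : ℝ[X]) :
    cfc (fun y => p.eval y) T = aeval T p := cfc_polynomial p T hT

/-- The spectral measure of a Jacobi operator at the first basis vector is an orthogonality measure,
because `pₙ(T) e₀` is a multiple of `eₙ`. -/
theorem IsJacobiOperator.isOrthogonalityMeasure {T : H →L[ℂ] H} {e : ℕ → H} {b a : ℕ → ℝ}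
    (h : IsJacobiOperator T e b a) (he : Orthonormal ℂ e) (ha : ∀ n, 0 ≤ a n) {μ : Measure ℝ}
    (hμ : IsSpectralMeasure T (e 0) μ) : IsOrthogonalityMeasure (recPoly b a) μ := by
  have := hμ.isFiniteMeasure
  refine ⟨⟨?_⟩, fun n => integrable_of_ae_mem_Icc hμ.ae_mem (by fun_prop), fun m n hmn => ?_⟩
  · have h1 := hμ.integral_eq (fun _ => 1) continuous_const
    rw [cfc_const_one ℝ T h.isSelfAdjoint] at h1
    simp only [integral_const, smul_eq_mul, mul_one, one_apply_eq_self,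
      inner_self_eq_norm_sq_to_K, he.1 0] at h1
    rw [measureReal_def] at h1
    exact (ENNReal.toReal_eq_one_iff _).1 (by simpa using h1)
  · have h1 := hμ.integral_eq (fun y => (recPoly b a m * recPoly b a n).eval y) (by fun_prop)
    rw [cfc_polynomial_eval h.isSelfAdjoint, map_mul, mul_apply_eq_comp] at h1
    have hsa : IsSelfAdjoint (aeval T (recPoly b a m)) := by
      rw [← cfc_polynomial_eval h.isSelfAdjoint]
      exact cfc_predicate _ T
    have h2 := ContinuousLinearMap.isSelfAdjoint_iff_isSymmetric.1 hsa (e 0)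
      (aeval T (recPoly b a n) (e 0))
    simp only [ContinuousLinearMap.coe_coe] at h2
    rw [← h2, h.aeval_recPoly ha, h.aeval_recPoly ha, inner_smul_left, inner_smul_right,
      he.2 hmn] at h1
    simpa [eval_mul] using h1

theorem isSelfAdjoint_diagOp (e : HilbertBasis ℕ ℂ H) (β : ℕ →ᵇ ℝ) :
    IsSelfAdjoint (diagOp e β) := by
  rw [ContinuousLinearMap.isSelfAdjoint_iff_isSymmetric]
  intro v w
  simp only [ContinuousLinearMap.coe_coe]
  rw [← e.repr.inner_map_map, ← e.repr.inner_map_map, lp.inner_eq_tsum, lp.inner_eq_tsum]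
  refine tsum_congr fun n => ?_
  rw [repr_diagOp, repr_diagOp]
  simp
  ring

/-- The isometry `eₙ ↦ eₙ₊₁`. -/
noncomputable def shiftOp (e : HilbertBasis ℕ ℂ H) : H →L[ℂ] H :=
  ((e.orthonormal.comp (· + 1) (add_left_injective 1)).orthogonalFamily.linearIsometry.comp
    e.repr.toLinearIsometry).toContinuousLinearMap

theorem shiftOp_apply_self (e : HilbertBasis ℕ ℂ H) (n : ℕ) : shiftOp e (e n) = e (n + 1) := by
  have h := (e.orthonormal.comp (· + 1) (add_left_injective 1)).orthogonalFamily
    |>.linearIsometry_apply_single (i := n) (1 : ℂ)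
  rw [← e.repr_self] at h
  exact h.trans (one_smul ℂ _)

theorem norm_shiftOp_le (e : HilbertBasis ℕ ℂ H) : ‖shiftOp e‖ ≤ 1 :=
  LinearIsometry.norm_toContinuousLinearMap_le _

/-- The operator with diagonal `β` and off-diagonal `α` in the Hilbert basis `e`. -/
noncomputable def tridiagOp (e : HilbertBasis ℕ ℂ H) (β α : ℕ →ᵇ ℝ) : H →L[ℂ] H :=
  diagOp e β + (shiftOp e * diagOp e α + star (shiftOp e * diagOp e α))

theorem tridiagOp_isSelfAdjoint (e : HilbertBasis ℕ ℂ H) (β α : ℕ →ᵇ ℝ) :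
    IsSelfAdjoint (tridiagOp e β α) :=
  (isSelfAdjoint_diagOp e β).add (IsSelfAdjoint.add_star_self _)

theorem norm_tridiagOp_sub_le (e : HilbertBasis ℕ ℂ H) (β α γ : ℕ →ᵇ ℝ) :
    ‖tridiagOp e β α - tridiagOp e β γ‖ ≤ 2 * ‖α - γ‖ := by
  have h : tridiagOp e β α - tridiagOp e β γ =
      shiftOp e * diagOp e (α - γ) + star (shiftOp e * diagOp e (α - γ)) := by
    simp only [tridiagOp, diagOp_sub, mul_sub, star_sub]
    abel
  have h1 : ‖shiftOp e * diagOp e (α - γ)‖ ≤ ‖α - γ‖ := by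
    refine (norm_mul_le _ _).trans ?_
    have := norm_shiftOp_le e
    have := norm_diagOp_le e (α - γ)
    nlinarith [norm_nonneg (shiftOp e), norm_nonneg (diagOp e (α - γ))]
  rw [h]
  refine (norm_add_le _ _).trans ?_
  rw [norm_star]
  linarith

theorem isJacobiOperator_tridiagOp (e : HilbertBasis ℕ ℂ H) {β α : ℕ →ᵇ ℝ} {a : ℕ → ℝ}
    (hα : ∀ n, α n = √(a n)) : IsJacobiOperator (tridiagOp e β α) e β a := by
  have hS : ∀ n, (shiftOp e * diagOp e α) (e n) = (√(a n) : ℂ) • e (n + 1) := by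
    intro n
    rw [mul_apply_eq_comp, diagOp_apply_self, map_smul, shiftOp_apply_self, hα]
  have hon := orthonormal_iff_ite.1 e.orthonormal
  have hS' : ∀ m n, inner ℂ (e m) (star (shiftOp e * diagOp e α) (e n)) =
      if m + 1 = n then (√(a m) : ℂ) else 0 := by
    intro m n
    rw [ContinuousLinearMap.star_eq_adjoint, ContinuousLinearMap.adjoint_inner_right, hS,
      inner_smul_left, hon]
    simp
  have hz : star (shiftOp e * diagOp e α) (e 0) = 0 :=
    ext_inner_basis e fun m => by rw [hS']; simp
  have hs : ∀ n, star (shiftOp e * diagOp e α) (e (n + 1)) = (√(a n) : ℂ) • e n := fun n =>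
    ext_inner_basis e fun m => by
      rw [hS', inner_smul_right, hon]
      by_cases h : m = n
      · subst h; simp
      · simp [h]
  refine ⟨tridiagOp_isSelfAdjoint e β α, ?_, fun n => ?_⟩
  · simp only [tridiagOp, add_apply, hS, hz, diagOp_apply_self, add_zero,
      zero_add]
  · simp only [tridiagOp, add_apply, hS, hs, diagOp_apply_self]
    abel

end JacobiOperator

/-- A separable Hilbert space with a basis indexed by `ℕ`, as a bare existence statement: the
functional calculus is then used for a generic inner product space structure. -/
theorem exists_hilbertBasis : ∃ (H : Type) (_ : NormedAddCommGroup H) (_ : InnerProductSpace ℂ H)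
    (_ : CompleteSpace H), Nonempty (HilbertBasis ℕ ℂ H) :=
  ⟨lp (fun _ : ℕ => ℂ) 2, inferInstance, inferInstance, inferInstance,
    ⟨⟨LinearIsometryEquiv.refl ℂ _⟩⟩⟩

/-! ### The second-order Taylor quotient -/

/-- The continuous `g` with `f y = f x + f' x (y - x) + (y - x)² g y`, for `f` of class `C²`. -/
noncomputable def taylorQuot (f : ℝ → ℝ) (x y : ℝ) : ℝ :=
  if y = x then iteratedDeriv 2 f x / 2 else (f y - f x - deriv f x * (y - x)) / (y - x) ^ 2

theorem taylorQuot_self (f : ℝ → ℝ) (x : ℝ) : taylorQuot f x x = iteratedDeriv 2 f x / 2 :=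
  if_pos rfl

theorem eq_add_taylorQuot (f : ℝ → ℝ) (x y : ℝ) :
    f y = f x + deriv f x * (y - x) + (y - x) * taylorQuot f x y * (y - x) := by
  rcases eq_or_ne y x with rfl | h
  · simp
  · have : y - x ≠ 0 := sub_ne_zero.2 h
    rw [taylorQuot, if_neg h]
    field_simp
    ring

theorem exists_taylorQuot_eq {f : ℝ → ℝ} (hf : ContDiff ℝ 2 f) (x y : ℝ) :
    ∃ ξ ∈ Set.uIcc x y, taylorQuot f x y = iteratedDeriv 2 f ξ / 2 := by
  rcases eq_or_ne y x with rfl | h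
  · exact ⟨y, by simp, taylorQuot_self f y⟩
  · obtain ⟨ξ, hξ, hE⟩ := taylor_mean_remainder_lagrange_iteratedDeriv (n := 1) h.symm
      (by norm_num; exact hf.contDiffOn)
    refine ⟨ξ, Set.uIoo_subset_uIcc_self hξ, ?_⟩
    have hd : derivWithin f (Set.uIcc x y) x = deriv f x :=
      (hf.differentiable (by norm_num) x).derivWithin
        (uniqueDiffOn_Icc (inf_lt_sup.2 h.symm) x Set.left_mem_uIcc)
    rw [taylorWithinEval_succ, taylor_within_zero_eval, iteratedDerivWithin_one, hd] at hE
    have hne : y - x ≠ 0 := sub_ne_zero.2 h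
    norm_num at hE
    rw [taylorQuot, if_neg h, div_eq_iff (pow_ne_zero 2 hne)]
    linarith

theorem continuous_taylorQuot {f : ℝ → ℝ} (hf : ContDiff ℝ 2 f) (x : ℝ) :
    Continuous (taylorQuot f x) := by
  have hf2 : Continuous (iteratedDeriv 2 f) := hf.continuous_iteratedDeriv 2 le_rfl
  rw [continuous_iff_continuousAt]
  intro y
  rcases eq_or_ne y x with rfl | h
  · choose ξ hξ hE using exists_taylorQuot_eq hf y
    have hlim : Tendsto ξ (𝓝 y) (𝓝 y) := by
      rw [tendsto_iff_dist_tendsto_zero]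
      refine squeeze_zero (fun _ => dist_nonneg) (g := fun z => |z - y|) (fun z => ?_) ?_
      · exact Set.abs_sub_left_of_mem_uIcc (hξ z)
      · have : Continuous fun z : ℝ => |z - y| := by fun_prop
        simpa using this.tendsto y
    have h1 := ((hf2.tendsto y).comp hlim).div_const 2
    rw [← taylorQuot_self] at h1
    exact h1.congr fun z => (hE z).symm
  · have hfc := hf.continuous
    have h1 : ContinuousAt (fun y => (f y - f x - deriv f x * (y - x)) / (y - x) ^ 2) y :=
      ContinuousAt.div (by fun_prop) (by fun_prop) (pow_ne_zero 2 (sub_ne_zero.2 h))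
    refine h1.congr ?_
    filter_upwards [isOpen_ne.mem_nhds h] with z hz
    rw [taylorQuot, if_neg hz]

theorem abs_taylorQuot_le {f : ℝ → ℝ} (hf : ContDiff ℝ 2 f) {K : ℝ}
    (hK : ∀ x, |iteratedDeriv 2 f x| ≤ K) (x y : ℝ) : |taylorQuot f x y| ≤ K / 2 := by
  obtain ⟨ξ, -, hE⟩ := exists_taylorQuot_eq hf x y
  rw [hE, abs_div, abs_two]
  linarith [hK ξ]

theorem quotDeriv_eq_taylorQuot {f : ℝ → ℝ} (hf : Differentiable ℝ f) {x y : ℝ} (h : y ≠ x) :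
    quotDeriv f x y = taylorQuot f x y := by
  have hne : y - x ≠ 0 := sub_ne_zero.2 h
  have h1 := (((hf x).hasDerivAt).const_sub (f y)).div ((hasDerivAt_id x).const_sub y) hne
  rw [quotDeriv, taylorQuot, if_neg h]
  refine h1.deriv.trans ?_
  simp only [id]
  congr 1
  ring

theorem quotDerivExt_eq_taylorQuot {f : ℝ → ℝ} (hf : ContDiff ℝ 2 f) (x y : ℝ) :
    quotDerivExt f x y = taylorQuot f x y := by
  rcases eq_or_ne y x with rfl | h
  · have h1 : (fun z => dslope f z y) = fun z => deriv f y + (z - y) * taylorQuot f y z := by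
      funext z
      rcases eq_or_ne z y with rfl | hz
      · simp
      · have hne : y - z ≠ 0 := sub_ne_zero.2 hz.symm
        have hE := eq_add_taylorQuot f y z
        rw [dslope_of_ne _ hz.symm, slope_def_field, div_eq_iff hne]
        linear_combination -hE
    have h2 : HasDerivAt (fun z => (z - y) * taylorQuot f y z) (taylorQuot f y y) y := by
      rw [hasDerivAt_iff_tendsto_slope]
      refine (((continuous_taylorQuot hf y).tendsto y).mono_left nhdsWithin_le_nhds).congr' ?_
      filter_upwards [self_mem_nhdsWithin] with z hz
      have hne : z - y ≠ 0 := sub_ne_zero.2 hz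
      rw [slope_def_field]
      field_simp
      ring
    rw [quotDerivExt, h1]
    exact (h2.const_add _).deriv
  · rw [← quotDeriv_eq_taylorQuot (hf.differentiable (by norm_num)) h, quotDerivExt, quotDeriv]
    refine Filter.EventuallyEq.deriv_eq ?_
    filter_upwards [isOpen_ne.mem_nhds h.symm] with z hz
    rw [dslope_of_ne _ (Ne.symm hz), slope_def_field]

/-! ### Spectral form of the difference quotients -/

section SpectralForm

variable {H : Type*} [NormedAddCommGroup H] [InnerProductSpace ℂ H] [CompleteSpace H]

theorem IsJacobiOperator.existsUnique {T : H →L[ℂ] H} {e : ℕ → H} {b a : ℕ → ℝ}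
    (h : IsJacobiOperator T e b a) (he : Orthonormal ℂ e) (ha : ∀ n, 0 ≤ a n) :
    ∃! μ, IsOrthogonalityMeasure (recPoly b a) μ := by
  obtain ⟨μ, hμ⟩ := exists_isSpectralMeasure h.isSelfAdjoint (e 0)
  have hμ' := h.isOrthogonalityMeasure he ha hμ
  exact ⟨μ, hμ', fun ν hν => hν.eq_of_ae_mem_Icc (norm_nonneg T) hμ' hμ.ae_mem⟩

theorem IsJacobiOperator.isSpectralMeasure {T : H →L[ℂ] H} {e : ℕ → H} {b a : ℕ → ℝ}
    (h : IsJacobiOperator T e b a) (he : Orthonormal ℂ e) (ha : ∀ n, 0 ≤ a n) :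
    IsSpectralMeasure T (e 0) (orthogonalityMeasure (recPoly b a)) := by
  obtain ⟨μ, hμ⟩ := exists_isSpectralMeasure h.isSelfAdjoint (e 0)
  have hμ' := h.isOrthogonalityMeasure he ha hμ
  have := (orthogonalityMeasure_spec hμ').eq_of_ae_mem_Icc (norm_nonneg T) hμ' hμ.ae_mem
  rwa [this]

/-- Since `(T - b₀) e₀ = √a₀ e₁`, the second-order Taylor remainder of `f` at `b₀` contributes `a₀`
times the matrix entry of the Taylor quotient at `e₁`. -/
theorem IsJacobiOperator.integral_sub_eq {T : H →L[ℂ] H} {e : ℕ → H} {b a : ℕ → ℝ}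
    (h : IsJacobiOperator T e b a) (he : Orthonormal ℂ e) (ha : ∀ n, 0 ≤ a n) {μ : Measure ℝ}
    (hμ : IsSpectralMeasure T (e 0) μ) {f : ℝ → ℝ} (hf : ContDiff ℝ 2 f) :
    ∫ y, f y ∂μ - f (b 0) =
      a 0 * (inner ℂ (e 1) (cfc (taylorQuot f (b 0)) T (e 1))).re := by
  have hT := h.isSelfAdjoint
  have hg := continuous_taylorQuot hf (b 0)
  set g := taylorQuot f (b 0)
  set D := cfc (fun y => y - b 0) T with hD
  have hDsa : IsSelfAdjoint D := cfc_predicate _ T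
  have hDe : D (e 0) = (√(a 0) : ℂ) • e 1 := by
    have h1 := h.aeval_recPoly ha 1
    rw [← cfc_polynomial_eval hT] at h1
    simpa [recPoly, hD] using h1
  -- The factor `(y - b₀)²` is put on both sides of `g`, so that each half can act on `e₀`.
  have hcfc : cfc f T = algebraMap ℝ _ (f (b 0)) + deriv f (b 0) • D + D * cfc g T * D := by
    have h1 : f = fun y => f (b 0) + deriv f (b 0) * (y - b 0) + (y - b 0) * g y * (y - b 0) :=
      funext fun y => eq_add_taylorQuot f (b 0) y
    have hgc : ContinuousOn g (spectrum ℝ T) := hg.continuousOn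
    conv_lhs => rw [h1]
    rw [cfc_add (a := T) (fun y => f (b 0) + deriv f (b 0) * (y - b 0))
        (fun y => (y - b 0) * g y * (y - b 0)),
      cfc_add (a := T) (fun _ => f (b 0)) (fun y => deriv f (b 0) * (y - b 0)),
      cfc_const _ T, cfc_const_mul _ (fun y => y - b 0) T,
      cfc_mul (fun y => (y - b 0) * g y) (fun y => y - b 0) T,
      cfc_mul (fun y => y - b 0) g T]
  have hsymm := ContinuousLinearMap.isSelfAdjoint_iff_isSymmetric.1 hDsa (e 0)
  simp only [ContinuousLinearMap.coe_coe, hDe] at hsymm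
  have hsq : √(a 0) * √(a 0) = a 0 := Real.mul_self_sqrt (ha 0)
  rw [hμ.integral_eq f hf.continuous, hcfc, add_apply, add_apply, mul_apply_eq_comp,
    mul_apply_eq_comp, inner_add_right, inner_add_right, ← hsymm, smul_apply, hDe, map_smul,
    inner_smul_left, inner_smul_right, Algebra.algebraMap_eq_smul_one, smul_apply,
    one_apply_eq_self, inner_smul_right_eq_smul, inner_smul_right_eq_smul, inner_smul_right,
    he.2 (zero_ne_one), inner_self_eq_norm_sq_to_K, he.1 0, ← mul_assoc]
  simp [← Complex.ofReal_mul, hsq]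

end SpectralForm

/-! ### The Jacobi coefficients of the `q`-Meixner process -/

/-- Diagonal Jacobi coefficients of the transition probabilities. -/
noncomputable def diagCoeff (θ q x : ℝ) (n : ℕ) : ℝ := θ * qInt q n + x * q ^ n

/-- Squared off-diagonal Jacobi coefficients of the transition probabilities. -/
noncomputable def offDiagCoeff (τ q s t : ℝ) (n : ℕ) : ℝ :=
  (t - s * q ^ n + τ * qInt q n) * qInt q (n + 1)

theorem transPoly_eq_recPoly (θ τ q s t x : ℝ) :
    transPoly θ τ q s t x = recPoly (diagCoeff θ q x) (offDiagCoeff τ q s t) := by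
  funext n
  induction n using Nat.strong_induction_on with
  | _ n ih =>
    match n with
    | 0 => rfl
    | 1 => simp [transPoly, recPoly, diagCoeff, qInt]
    | n + 2 =>
      rw [transPoly, recPoly, ih (n + 1) (by omega), ih n (by omega)]
      rfl

/-- The polynomials `Wₙ` are the associated polynomials of the `Qₙ` at `s = t`: their coefficients
are shifted by one, because `1 - q ^ (n + 1) = (1 - q) [n + 1]_q`. -/
theorem genPoly_eq_recPoly (θ τ q x t : ℝ) :
    genPoly θ τ q x t =
      recPoly (fun n => diagCoeff θ q x (n + 1)) (fun n => offDiagCoeff τ q t t (n + 1)) := by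
  funext n
  induction n using Nat.strong_induction_on with
  | _ n ih =>
    match n with
    | 0 => rfl
    | 1 => rfl
    | n + 2 =>
      have h : ((1 - q) * t + τ) * qInt q (n + 1) * qInt q (n + 2) =
          offDiagCoeff τ q t t (n + 1) := by
        have hgeom : (1 - q) * qInt q (n + 1) = 1 - q ^ (n + 1) := mul_neg_geom_sum q (n + 1)
        rw [offDiagCoeff]
        linear_combination t * qInt q (n + 2) * hgeom
      rw [genPoly, recPoly, ih (n + 1) (by omega), ih n (by omega), h]
      rfl

theorem qInt_nonneg {q : ℝ} (hq₁ : -1 < q) (n : ℕ) : 0 ≤ qInt q n := by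
  rcases n with _ | n
  · simp [qInt]
  · exact (geom_sum_pos' (by linarith) (Nat.succ_ne_zero n)).le

theorem abs_qpow_le_one {q : ℝ} (hq₁ : -1 < q) (hq₂ : q < 1) (n : ℕ) : |q ^ n| ≤ 1 := by
  rw [abs_pow]
  exact pow_le_one₀ (abs_nonneg q) (abs_le.2 ⟨hq₁.le, hq₂.le⟩)

theorem qInt_le {q : ℝ} (hq₁ : -1 < q) (hq₂ : q < 1) (n : ℕ) : qInt q n ≤ 2 / (1 - q) := by
  have hgeom : (1 - q) * qInt q n = 1 - q ^ n := mul_neg_geom_sum q n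
  rw [le_div_iff₀ (by linarith)]
  linarith [(abs_le.1 (abs_qpow_le_one hq₁ hq₂ n)).1]

theorem offDiagCoeff_nonneg {τ q s t : ℝ} (hτ : 0 ≤ τ) (hq₁ : -1 < q) (hq₂ : q < 1) (hs : 0 ≤ s)
    (hst : s ≤ t) (n : ℕ) : 0 ≤ offDiagCoeff τ q s t n := by
  have h1 := (abs_le.1 (abs_qpow_le_one hq₁ hq₂ n)).2
  have h2 : s * q ^ n ≤ s := mul_le_of_le_one_right hs h1
  have h3 := mul_nonneg hτ (qInt_nonneg hq₁ n)
  exact mul_nonneg (by linarith) (qInt_nonneg hq₁ _)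

theorem abs_sqrt_sub_sqrt_le (u v : ℝ) : |√u - √v| ≤ √|u - v| := by
  wlog h : v ≤ u generalizing u v
  · rw [abs_sub_comm, abs_sub_comm u]
    exact this v u (le_of_not_ge h)
  rw [abs_of_nonneg (sub_nonneg.2 (Real.sqrt_le_sqrt h)), abs_of_nonneg (sub_nonneg.2 h),
    sub_le_iff_le_add]
  rcases le_total 0 v with hv | hv
  · refine Real.sqrt_le_left (by positivity) |>.2 ?_
    nlinarith [Real.sq_sqrt hv, Real.sq_sqrt (sub_nonneg.2 h),
      mul_nonneg (Real.sqrt_nonneg (u - v)) (Real.sqrt_nonneg v)]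
  · rw [Real.sqrt_eq_zero_of_nonpos hv, add_zero]
    exact Real.sqrt_le_sqrt (by linarith)

theorem abs_offDiagCoeff_sub_le {τ q : ℝ} (hq₁ : -1 < q) (hq₂ : q < 1) (s t s' t' : ℝ) (n : ℕ) :
    |offDiagCoeff τ q s t n - offDiagCoeff τ q s' t' n| ≤
      (|t - t'| + |s - s'|) * (2 / (1 - q)) := by
  have h : offDiagCoeff τ q s t n - offDiagCoeff τ q s' t' n =
      ((t - t') - (s - s') * q ^ n) * qInt q (n + 1) := by
    simp only [offDiagCoeff]; ring
  rw [h, abs_mul, abs_of_nonneg (qInt_nonneg hq₁ _)]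
  refine mul_le_mul ((abs_sub _ _).trans ?_) (qInt_le hq₁ hq₂ _) (qInt_nonneg hq₁ _) (by positivity)
  rw [abs_mul]
  have := mul_le_of_le_one_right (abs_nonneg (s - s')) (abs_qpow_le_one hq₁ hq₂ n)
  linarith

theorem exists_boundedContinuous_diagCoeff {q : ℝ} (hq₁ : -1 < q) (hq₂ : q < 1) (θ x : ℝ) :
    ∃ β : ℕ →ᵇ ℝ, ⇑β = diagCoeff θ q x := by
  refine ⟨BoundedContinuousFunction.ofNormedAddCommGroupDiscrete (diagCoeff θ q x)
    (|θ| * (2 / (1 - q)) + |x|) fun n => ?_, rfl⟩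
  rw [Real.norm_eq_abs, diagCoeff]
  refine (abs_add_le _ _).trans ?_
  rw [abs_mul, abs_mul, abs_of_nonneg (qInt_nonneg hq₁ n)]
  have h1 := mul_le_mul_of_nonneg_left (qInt_le hq₁ hq₂ n) (abs_nonneg θ)
  have h2 := mul_le_of_le_one_right (abs_nonneg x) (abs_qpow_le_one hq₁ hq₂ n)
  linarith

theorem exists_boundedContinuous_offDiagCoeff {q : ℝ} (hq₁ : -1 < q) (hq₂ : q < 1) (τ s t : ℝ) :
    ∃ α : ℕ →ᵇ ℝ, ∀ n, α n = √(offDiagCoeff τ q s t n) := by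
  refine ⟨BoundedContinuousFunction.ofNormedAddCommGroupDiscrete
    (fun n => √(offDiagCoeff τ q s t n))
    √((|t| + |s| + |τ| * (2 / (1 - q))) * (2 / (1 - q))) fun n => ?_, fun n => rfl⟩
  rw [Real.norm_of_nonneg (Real.sqrt_nonneg _)]
  refine Real.sqrt_le_sqrt ?_
  have h1 := qInt_nonneg hq₁ n
  have h2 := qInt_le hq₁ hq₂ n
  have h3 : -(s * q ^ n) ≤ |s| := by
    have h4 := neg_abs_le (s * q ^ n)
    rw [abs_mul] at h4
    linarith [mul_le_of_le_one_right (abs_nonneg s) (abs_qpow_le_one hq₁ hq₂ n)]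
  have h5 : τ * qInt q n ≤ |τ| * (2 / (1 - q)) :=
    mul_le_mul (le_abs_self τ) h2 h1 (abs_nonneg τ)
  have hpos : 0 < 2 / (1 - q) := div_pos two_pos (by linarith)
  exact mul_le_mul (by linarith [le_abs_self t]) (qInt_le hq₁ hq₂ _) (qInt_nonneg hq₁ _)
    (by positivity)

/-! ### The difference quotients and their limit -/

/-- Existence and uniqueness of the measures, together with the numbers `Φ s t g = ⟨e₁, g(J) e₁⟩`
for the Jacobi operator `J` of `P_{s,t}(x, ·)`: they represent the difference quotients, are bounded
by the supremum norm of `g`, and depend continuously on `(s, t)` up to the diagonal. On the diagonal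
the Jacobi operator splits and what remains has spectral measure `ν_{x,t}`. -/
theorem exists_quotient_representation {θ τ q : ℝ} (hτ : 0 ≤ τ) (hq₁ : -1 < q) (hq₂ : q < 1)
    (x : ℝ) : ∃ Φ : ℝ → ℝ → (ℝ → ℝ) → ℝ,
      (∀ s t, 0 ≤ s → s < t → ∃! μ, IsOrthogonalityMeasure (transPoly θ τ q s t x) μ) ∧
      (∀ t, 0 ≤ t → ∃! μ, IsOrthogonalityMeasure (genPoly θ τ q x t) μ) ∧
      (∀ s t f, 0 ≤ s → s < t → ContDiff ℝ 2 f →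
        transOp θ τ q s t f x - f x = (t - s) * Φ s t (taylorQuot f x)) ∧
      (∀ s t g K, (∀ y, |g y| ≤ K) → |Φ s t g| ≤ K) ∧
      (∀ t g, 0 ≤ t → Continuous g → Integrable g (genMeasure θ τ q x t) ∧
        Tendsto (fun p : ℝ × ℝ => Φ p.1 p.2 g) (𝓝 (t, t))
          (𝓝 (∫ y, g y ∂(genMeasure θ τ q x t)))) := by
  obtain ⟨H, _, _, _, ⟨e⟩⟩ := exists_hilbertBasis
  obtain ⟨β, hβ⟩ := exists_boundedContinuous_diagCoeff hq₁ hq₂ θ x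
  choose α hα using exists_boundedContinuous_offDiagCoeff hq₁ hq₂ τ
  let T : ℝ → ℝ → H →L[ℂ] H := fun s t => tridiagOp e β (α s t)
  have hJ : ∀ s t, IsJacobiOperator (T s t) e (diagCoeff θ q x) (offDiagCoeff τ q s t) := by
    intro s t
    rw [← hβ]
    exact isJacobiOperator_tridiagOp e (hα s t)
  have ha : ∀ s t, 0 ≤ s → s ≤ t → ∀ n, 0 ≤ offDiagCoeff τ q s t n := fun s t hs hst =>
    offDiagCoeff_nonneg hτ hq₁ hq₂ hs hst
  have ha0 : ∀ s t, offDiagCoeff τ q s t 0 = t - s := fun s t => by simp [offDiagCoeff, qInt]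
  have hb0 : diagCoeff θ q x 0 = x := by simp [diagCoeff, qInt]
  have htail : ∀ t, IsJacobiOperator (T t t) (fun n => e (n + 1))
      (fun n => diagCoeff θ q x (n + 1)) (fun n => offDiagCoeff τ q t t (n + 1)) := fun t =>
    (hJ t t).tail (by rw [ha0, sub_self])
  have heo := e.orthonormal
  have heo' : Orthonormal ℂ (fun n => e (n + 1)) := heo.comp (· + 1) (add_left_injective 1)
  refine ⟨fun s t g => (inner ℂ (e 1) (cfc g (T s t) (e 1))).re, fun s t hs hst => ?_,
    fun t ht => ?_, fun s t f hs hst hf => ?_, fun s t g K hg => ?_, fun t g ht hg => ?_⟩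
  · rw [transPoly_eq_recPoly]
    exact (hJ s t).existsUnique heo (ha s t hs hst.le)
  · rw [genPoly_eq_recPoly]
    exact (htail t).existsUnique heo' fun n => ha t t ht le_rfl _
  · have h := (hJ s t).isSpectralMeasure heo (ha s t hs hst.le)
    have h1 := (hJ s t).integral_sub_eq heo (ha s t hs hst.le) h hf
    rw [ha0, hb0] at h1
    rwa [transOp, transProb, transPoly_eq_recPoly]
  · have hK : 0 ≤ K := (abs_nonneg _).trans (hg 0)
    have h1 : ‖cfc g (T s t)‖ ≤ K := norm_cfc_le hK fun y _ => hg y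
    refine (Complex.abs_re_le_norm _).trans ((norm_inner_le_norm _ _).trans ?_)
    have h2 := (cfc g (T s t)).le_opNorm (e 1)
    rw [heo.1 1, mul_one] at h2
    rw [heo.1 1, one_mul]
    exact h2.trans h1
  · have hν : IsSpectralMeasure (T t t) (e 1) (genMeasure θ τ q x t) := by
      rw [genMeasure, genPoly_eq_recPoly]
      exact (htail t).isSpectralMeasure heo' fun n => ha t t ht le_rfl _
    have := hν.isFiniteMeasure
    refine ⟨integrable_of_ae_mem_Icc hν.ae_mem hg, ?_⟩
    rw [hν.integral_eq g hg]
    have hT : Tendsto (fun p : ℝ × ℝ => T p.1 p.2) (𝓝 (t, t)) (𝓝 (T t t)) := by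
      rw [tendsto_iff_norm_sub_tendsto_zero]
      refine squeeze_zero (fun _ => norm_nonneg _)
        (g := fun p : ℝ × ℝ => 2 * √((|p.2 - t| + |p.1 - t|) * (2 / (1 - q)))) (fun p => ?_) ?_
      · refine (norm_tridiagOp_sub_le e β _ _).trans ?_
        gcongr
        refine (BoundedContinuousFunction.norm_le (Real.sqrt_nonneg _)).2 fun n => ?_
        rw [BoundedContinuousFunction.sub_apply, hα, hα]
        exact (abs_sqrt_sub_sqrt_le _ _).trans
          (Real.sqrt_le_sqrt (abs_offDiagCoeff_sub_le hq₁ hq₂ _ _ _ _ n))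
      · have : Continuous fun p : ℝ × ℝ =>
            2 * √((|p.2 - t| + |p.1 - t|) * (2 / (1 - q))) := by fun_prop
        simpa using this.tendsto (t, t)
    have hspec : ∀ᶠ p : ℝ × ℝ in 𝓝 (t, t),
        spectrum ℝ (T p.1 p.2) ⊆ Set.Icc (-(‖T t t‖ + 1)) (‖T t t‖ + 1) := by
      filter_upwards [hT.norm.eventually (eventually_le_nhds (lt_add_one ‖T t t‖))] with p hp
      exact (spectrum_subset_Icc _).trans (Set.Icc_subset_Icc (neg_le_neg hp) hp)
    have hcfc := hT.cfc isCompact_Icc g hspec (.of_forall fun p => (hJ p.1 p.2).isSelfAdjoint)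
      ((spectrum_subset_Icc _).trans (Set.Icc_subset_Icc (by linarith) (by linarith)))
      (hJ t t).isSelfAdjoint hg.continuousOn
    have hcont : Continuous fun A : H →L[ℂ] H => (inner ℂ (e 1) (A (e 1))).re := by fun_prop
    exact (hcont.tendsto _).comp hcfc

theorem integrableOn_quotDeriv {f : ℝ → ℝ} (hf : ContDiff ℝ 2 f) {x : ℝ} {ν : Measure ℝ}
    (h : Integrable (taylorQuot f x) ν) : IntegrableOn (fun y => quotDeriv f x y) {x}ᶜ ν :=
  h.integrableOn.congr_fun (fun _ hy =>
    (quotDeriv_eq_taylorQuot (hf.differentiable two_ne_zero) hy).symm)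
    (measurableSet_singleton x).compl

theorem singularIntegral_eq {θ τ q t : ℝ} {f : ℝ → ℝ} (hf : ContDiff ℝ 2 f) {x : ℝ}
    (h : Integrable (taylorQuot f x) (genMeasure θ τ q x t)) :
    singularIntegral θ τ q t f x = ∫ y, taylorQuot f x y ∂(genMeasure θ τ q x t) := by
  rw [singularIntegral, ← integral_add_compl (measurableSet_singleton x) h,
    integral_singleton, taylorQuot_self, smul_eq_mul,
    setIntegral_congr_fun (measurableSet_singleton x).compl fun _ hy =>
      quotDeriv_eq_taylorQuot (hf.differentiable two_ne_zero) hy]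
  ring

/-- The content of the theorem for a single function of class `C²`, bounded or not. -/
theorem tendsto_quotients {θ τ q : ℝ} (hτ : 0 ≤ τ) (hq₁ : -1 < q) (hq₂ : q < 1) {t : ℝ}
    (ht : 0 < t) {f : ℝ → ℝ} (hf : ContDiff ℝ 2 f) (x : ℝ) :
    Integrable (taylorQuot f x) (genMeasure θ τ q x t) ∧
    Tendsto (fun h => leftQuotient θ τ q t f h x) (𝓝[>] 0)
      (𝓝 (singularIntegral θ τ q t f x)) ∧
    Tendsto (fun h => rightQuotient θ τ q t f h x) (𝓝[>] 0)
      (𝓝 (singularIntegral θ τ q t f x)) ∧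
    ∀ K, (∀ y, |iteratedDeriv 2 f y| ≤ K) → ∀ h, 0 < h →
      (h ≤ t → |leftQuotient θ τ q t f h x| ≤ K / 2) ∧ |rightQuotient θ τ q t f h x| ≤ K / 2 := by
  obtain ⟨Φ, -, -, hΦ, hbound, hlim⟩ :=
    exists_quotient_representation (θ := θ) hτ hq₁ hq₂ x
  obtain ⟨hint, hlim⟩ := hlim t _ ht.le (continuous_taylorQuot hf x)
  rw [← singularIntegral_eq hf hint] at hlim
  have hl : ∀ h, 0 < h → h ≤ t →
      leftQuotient θ τ q t f h x = Φ (t - h) t (taylorQuot f x) := by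
    intro h hh hht
    rw [leftQuotient, hΦ (t - h) t f (by linarith) (by linarith) hf]
    field_simp
    ring
  have hr : ∀ h, 0 < h → rightQuotient θ τ q t f h x = Φ t (t + h) (taylorQuot f x) := by
    intro h hh
    rw [rightQuotient, hΦ t (t + h) f ht.le (by linarith) hf]
    field_simp
    ring
  refine ⟨hint, ?_, ?_, fun K hK h hh => ⟨fun hht => ?_, ?_⟩⟩
  · have h1 : Tendsto (fun h : ℝ => (t - h, t)) (𝓝[>] 0) (𝓝 (t, t)) := by
      have : Continuous fun h : ℝ => (t - h, t) := by fun_prop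
      simpa using (this.tendsto 0).mono_left nhdsWithin_le_nhds
    refine (hlim.comp h1).congr' ?_
    filter_upwards [Ioc_mem_nhdsGT ht] with h hh
    exact (hl h hh.1 hh.2).symm
  · have h1 : Tendsto (fun h : ℝ => (t, t + h)) (𝓝[>] 0) (𝓝 (t, t)) := by
      have : Continuous fun h : ℝ => (t, t + h) := by fun_prop
      simpa using (this.tendsto 0).mono_left nhdsWithin_le_nhds
    refine (hlim.comp h1).congr' ?_
    filter_upwards [self_mem_nhdsWithin] with h hh
    exact (hr h hh).symm
  · rw [hl h hh hht]
    exact hbound _ _ _ _ (abs_taylorQuot_le hf hK x)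
  · rw [hr h hh]
    exact hbound _ _ _ _ (abs_taylorQuot_le hf hK x)

end QMeixner

theorem theorem1p1 (θ τ q : ℝ) (hτ : 0 ≤ τ) (hq₁ : -1 < q) (hq₂ : q < 1) :
    -- the measures `P_{s,t}(x, dy)` and `ν_{x,t}(dy)` are well defined
    (∀ s t x : ℝ, 0 ≤ s → s < t →
      ∃! μ : MeasureTheory.Measure ℝ,
        QMeixner.IsOrthogonalityMeasure (QMeixner.transPoly θ τ q s t x) μ) ∧
    (∀ t x : ℝ, 0 < t →
      ∃! μ : MeasureTheory.Measure ℝ,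
        QMeixner.IsOrthogonalityMeasure (QMeixner.genPoly θ τ q x t) μ) ∧
    -- (i) bounded continuous functions with bounded continuous second derivative
    (∀ t : ℝ, 0 < t → ∀ f : BoundedContinuousFunction ℝ ℝ,
      ContDiff ℝ 2 f → (∃ K : ℝ, ∀ x : ℝ, |iteratedDeriv 2 f x| ≤ K) →
        f ∈ QMeixner.weakLeftDomain θ τ q t ∩ QMeixner.weakRightDomain θ τ q t ∧
        ∀ x : ℝ,
          MeasureTheory.IntegrableOn (fun y => QMeixner.quotDeriv f x y) {x}ᶜ
            (QMeixner.genMeasure θ τ q x t) ∧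
          QMeixner.leftGenerator θ τ q t f x = QMeixner.singularIntegral θ τ q t f x ∧
          QMeixner.rightGenerator θ τ q t f x = QMeixner.singularIntegral θ τ q t f x) ∧
    -- (ii) polynomials; the limits that define the generators are asserted to exist
    (∀ t : ℝ, 0 < t → ∀ p : Polynomial ℝ, ∀ x : ℝ,
      MeasureTheory.IntegrableOn (fun y => QMeixner.quotDeriv (fun z => p.eval z) x y) {x}ᶜ
        (QMeixner.genMeasure θ τ q x t) ∧
      MeasureTheory.Integrable (fun y => QMeixner.quotDerivExt (fun z => p.eval z) x y)
        (QMeixner.genMeasure θ τ q x t) ∧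
      Filter.Tendsto (fun h => QMeixner.leftQuotient θ τ q t (fun z => p.eval z) h x)
        (nhdsWithin 0 (Set.Ioi 0))
        (nhds (QMeixner.singularIntegral θ τ q t (fun z => p.eval z) x)) ∧
      Filter.Tendsto (fun h => QMeixner.rightQuotient θ τ q t (fun z => p.eval z) h x)
        (nhdsWithin 0 (Set.Ioi 0))
        (nhds (QMeixner.singularIntegral θ τ q t (fun z => p.eval z) x)) ∧
      QMeixner.singularIntegral θ τ q t (fun z => p.eval z) x =
        ∫ y, QMeixner.quotDerivExt (fun z => p.eval z) x y ∂(QMeixner.genMeasure θ τ q x t)) := by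
  open QMeixner in
  refine ⟨fun s t x hs hst => ?_, fun t x ht => ?_, fun t ht f hf hK => ?_, fun t ht p x => ?_⟩
  · obtain ⟨Φ, h, -⟩ := exists_quotient_representation (θ := θ) hτ hq₁ hq₂ x
    exact h s t hs hst
  · obtain ⟨Φ, -, h, -⟩ := exists_quotient_representation (θ := θ) hτ hq₁ hq₂ x
    exact h t ht.le
  · obtain ⟨K, hK⟩ := hK
    have hq := tendsto_quotients (θ := θ) hτ hq₁ hq₂ ht hf
    refine ⟨⟨⟨⟨K / 2, fun h hh hht x => ?_⟩, fun x => ⟨_, (hq x).2.1⟩⟩,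
      ⟨⟨K / 2, fun h hh x => ?_⟩, fun x => ⟨_, (hq x).2.2.1⟩⟩⟩, fun x =>
        ⟨integrableOn_quotDeriv hf (hq x).1, (hq x).2.1.limUnder_eq, (hq x).2.2.1.limUnder_eq⟩⟩
    · exact ((hq x).2.2.2 K hK h hh).1 hht
    · exact ((hq x).2.2.2 K hK h hh).2
  · have hf : ContDiff ℝ 2 fun z => p.eval z := by
      simpa only [coe_aeval_eq_eval] using p.contDiff_aeval (𝕜 := ℝ) 2
    obtain ⟨hint, hleft, hright, -⟩ := tendsto_quotients (θ := θ) hτ hq₁ hq₂ ht hf x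
    have hext : (fun y => quotDerivExt (fun z => p.eval z) x y) =
        taylorQuot (fun z => p.eval z) x := funext (quotDerivExt_eq_taylorQuot hf x)
    refine ⟨integrableOn_quotDeriv hf hint, ?_, hleft, hright, ?_⟩
    · rwa [hext]
    · rw [hext, singularIntegral_eq hf hint]
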